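/- Corollary 3.3 (Killing potential $\Rightarrow Ric(\nabla u,\nabla u)=0$). Let $(M,g)$ be a smooth finite-dimensional Riemannian manifold (Hausdorff, without boundary) which is complete, i.e. the exponential map is defined on all of $T_pM$ for every $p\in M$ (every tangent vector is the initial velocity of a geodesic defined on all of $\mathbb{R}$). Let $u\in C^\infty(M)$ be a Killing potential, that is, its gradient $\nabla u$ (the vector field with $g(\nabla u,X)=X(u)$ for all smooth vector fields $X$) is a Killing vector field: $\mathcal{L}_{\nabla u}g=0$, where $(\mathcal{L}_Xg)(Y,Z)=X(g(Y,Z))-g([X,Y],Z)-g(Y,[X,Z])$ for smooth vector fields $X,Y,Z$. Then $$Ric(\nabla u,\nabla u)_p=0\qquad\text{for every } p\in M,$$ where $Ric(Y,Z)=\operatorname{tr}\big(X\mapsto R(X,Y)Z\big)$ is the Ricci tensor of $g$, with $R(X,Y)Z=\nabla_X\nabla_YZ-\nabla_Y\nabla_XZ-\nabla_{[X,Y]}Z$ for the Levi-Civita connection $\nabla$. -/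

import Mathlib

open scoped Manifold ContDiff Bundle
open Bundle VectorField

noncomputable section

namespace KillingPotential

/-! ### Calculus of a metric `G` on an open subset of a vector space `E`

`G y v w` is the value of the metric at the point `y` on the vectors `v`, `w`. -/

section Local

variable {E : Type*} [NormedAddCommGroup E] [NormedSpace ℝ E]

/-- The Christoffel symbols of the first kind, lowered in the last slot:
`christoffelFirst G y v w z = ½ (∂_v G(w, z) + ∂_w G(v, z) - ∂_z G(v, w))`. -/
def christoffelFirst (G : E → E →L[ℝ] E →L[ℝ] ℝ) (y v w : E) : E →L[ℝ] ℝ :=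
  (1 / 2 : ℝ) • (fderiv ℝ G y v w + fderiv ℝ G y w v - ((fderiv ℝ G y).flip v).flip w)

theorem christoffelFirst_apply (G : E → E →L[ℝ] E →L[ℝ] ℝ) (y v w z : E) :
    christoffelFirst G y v w z =
      1 / 2 * (fderiv ℝ G y v w z + fderiv ℝ G y w v z - fderiv ℝ G y z v w) := by
  simp [christoffelFirst]

/-- The Christoffel symbols (of the second kind) `Γ(v, w) = v^i w^j Γ^k_{ij} ∂_k`, obtained from
those of the first kind by raising the last index. They give the Levi-Civita connection of `G`
through `∇_X Y = DY(X) + Γ(X, Y)`. -/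
def christoffel (G : E → E →L[ℝ] E →L[ℝ] ℝ) (y v w : E) : E :=
  (G y).inverse (christoffelFirst G y v w)

/-- The curvature `R(X, Y) Z = ∇_X ∇_Y Z - ∇_Y ∇_X Z - ∇_{[X, Y]} Z` at the point `y`, computed with
constant extensions of the vectors `X`, `Y`, `Z`. -/
def localCurvature (G : E → E →L[ℝ] E →L[ℝ] ℝ) (y X Y Z : E) : E :=
  fderiv ℝ (fun q ↦ christoffel G q Y Z) y X - fderiv ℝ (fun q ↦ christoffel G q X Z) y Y
    + christoffel G y X (christoffel G y Y Z) - christoffel G y Y (christoffel G y X Z)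

/-- The Ricci curvature `Ric(Y, Z) = trace (X ↦ R(X, Y) Z)`, the trace being computed in a basis. -/
def localRicci [FiniteDimensional ℝ E] (G : E → E →L[ℝ] E →L[ℝ] ℝ) (y Y Z : E) : ℝ :=
  ∑ i, (Module.finBasis ℝ E).coord i (localCurvature G y (Module.finBasis ℝ E i) Y Z)

theorem exists_equiv_of_pos [FiniteDimensional ℝ E] (B : E →L[ℝ] E →L[ℝ] ℝ)
    (hB : ∀ v, v ≠ 0 → 0 < B v v) :
    ∃ e : E ≃L[ℝ] (E →L[ℝ] ℝ), (e : E →L[ℝ] E →L[ℝ] ℝ) = B := by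
  have hinj : Function.Injective B.toLinearMap := by
    refine (injective_iff_map_eq_zero _).2 fun w hw ↦ ?_
    by_contra hne
    have h1 := hB w hne
    have h2 : B w = 0 := hw
    simp [h2] at h1
  have hdim : Module.finrank ℝ E = Module.finrank ℝ (E →L[ℝ] ℝ) := by
    rw [← (LinearMap.toContinuousLinearMap (𝕜 := ℝ) (E := E) (F' := ℝ)).finrank_eq]
    exact Subspace.dual_finrank_eq.symm
  exact ⟨(LinearEquiv.ofInjectiveOfFinrankEq _ hinj hdim).toContinuousLinearEquiv, rfl⟩

end Local

/-! ### Riemannian manifolds -/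

section Manifold

variable {E : Type*} [NormedAddCommGroup E] [NormedSpace ℝ E]
  {M : Type*} [TopologicalSpace M] [ChartedSpace E M] [IsManifold 𝓘(ℝ, E) ∞ M]
  (g : ContMDiffRiemannianMetric 𝓘(ℝ, E) ∞ E (fun x : M ↦ TangentSpace 𝓘(ℝ, E) x))

/-- The metric in the preferred chart `φ` around `p`: the pullback of `g` by `φ⁻¹`. -/
def metricInChart (p : M) (y : E) : E →L[ℝ] E →L[ℝ] ℝ :=
  letI A : E →L[ℝ] E := mfderiv 𝓘(ℝ, E) 𝓘(ℝ, E) (extChartAt 𝓘(ℝ, E) p).symm y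
  letI B : E →L[ℝ] E →L[ℝ] ℝ := g.inner ((extChartAt 𝓘(ℝ, E) p).symm y)
  B.bilinearComp A A

/-- The Ricci curvature of `(M, g)` at `p`, computed in the preferred chart around `p`. -/
def ricci [FiniteDimensional ℝ E] (p : M) (v w : TangentSpace 𝓘(ℝ, E) p) : ℝ :=
  localRicci (metricInChart g p) (extChartAt 𝓘(ℝ, E) p p)
    (mfderiv 𝓘(ℝ, E) 𝓘(ℝ, E) (extChartAt 𝓘(ℝ, E) p) p v)
    (mfderiv 𝓘(ℝ, E) 𝓘(ℝ, E) (extChartAt 𝓘(ℝ, E) p) p w)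

/-- `γ : ℝ → M` is a geodesic, `∇_{γ'} γ' = 0`: around each time `t`, the expression `c` of `γ` in
the preferred chart around `γ t` satisfies `c'' + Γ(c', c') = 0` at `t`. -/
structure IsGeodesic (γ : ℝ → M) : Prop where
  smooth : ContMDiff 𝓘(ℝ, ℝ) 𝓘(ℝ, E) ∞ γ
  equation : ∀ t : ℝ,
    letI c : ℝ → E := fun s ↦ extChartAt 𝓘(ℝ, E) (γ t) (γ s)
    deriv (deriv c) t + christoffel (metricInChart g (γ t)) (c t) (deriv c t) (deriv c t) = 0

/-- `(M, g)` is (geodesically) complete: every tangent vector is the initial velocity of a geodesic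
defined for all times, i.e. the exponential map is defined on the whole tangent bundle. -/
def IsGeodesicallyComplete : Prop :=
  ∀ ξ : TangentBundle 𝓘(ℝ, E) M, ∃ γ : ℝ → M, IsGeodesic g γ ∧
    (⟨γ 0, mfderiv 𝓘(ℝ, ℝ) 𝓘(ℝ, E) γ 0 (1 : ℝ)⟩ : TangentBundle 𝓘(ℝ, E) M) = ξ

/-- The gradient of `u`: the vector field with `g(∇u, X) = X(u)`; see `inner_grad`. -/
def grad (u : M → ℝ) (p : M) : TangentSpace 𝓘(ℝ, E) p :=
  (g.inner p).inverse (mvfderiv 𝓘(ℝ, E) u p)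

theorem inner_grad [FiniteDimensional ℝ E] (u : M → ℝ) (p : M) (v : TangentSpace 𝓘(ℝ, E) p) :
    g.inner p (grad g u p) v = mvfderiv 𝓘(ℝ, E) u p v := by
  obtain ⟨e, he⟩ := exists_equiv_of_pos (E := E) (g.inner p : E →L[ℝ] E →L[ℝ] ℝ) (g.pos p)
  have key : ∀ α : E →L[ℝ] ℝ,
      (e : E →L[ℝ] E →L[ℝ] ℝ) ((e : E →L[ℝ] E →L[ℝ] ℝ).inverse α) = α := by simp
  rw [he] at key
  exact congrArg (fun α : E →L[ℝ] ℝ ↦ α v) (key (mvfderiv 𝓘(ℝ, E) u p))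

/-- `X` is a smooth vector field. -/
def IsSmoothVectorField (X : ∀ p : M, TangentSpace 𝓘(ℝ, E) p) : Prop :=
  ContMDiff 𝓘(ℝ, E) 𝓘(ℝ, E).tangent ∞ (fun p ↦ (⟨p, X p⟩ : TangentBundle 𝓘(ℝ, E) M))

/-- The Lie derivative of the metric,
`(𝓛_X g)(Y, Z) = X(g(Y, Z)) - g([X, Y], Z) - g(Y, [X, Z])`. -/
def lieDerivMetric (X Y Z : ∀ p : M, TangentSpace 𝓘(ℝ, E) p) (p : M) : ℝ :=
  mvfderiv 𝓘(ℝ, E) (fun q ↦ g.inner q (Y q) (Z q)) p (X p)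
    - g.inner p (mlieBracket 𝓘(ℝ, E) X Y p) (Z p) - g.inner p (Y p) (mlieBracket 𝓘(ℝ, E) X Z p)

/-- `X` is a Killing vector field: a smooth vector field with `𝓛_X g = 0`. -/
structure IsKillingField (X : ∀ p : M, TangentSpace 𝓘(ℝ, E) p) : Prop where
  smooth : IsSmoothVectorField X
  lieDeriv_eq_zero : ∀ Y Z : ∀ p : M, TangentSpace 𝓘(ℝ, E) p,
    IsSmoothVectorField Y → IsSmoothVectorField Z → ∀ p, lieDerivMetric g X Y Z p = 0

/-- `u` is a Killing potential: a smooth function whose gradient is a Killing vector field. -/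
structure IsKillingPotential (u : M → ℝ) : Prop where
  smooth : ContMDiff 𝓘(ℝ, E) 𝓘(ℝ, ℝ) ∞ u
  killing : IsKillingField g (grad g u)

end Manifold

end KillingPotential

end

/-! Write V = ∇u. The Killing equation says that the bilinear form g(∇_X V, Y) is skew; since V is a
gradient, this form is the Hessian of u, hence symmetric. So ∇V = 0, and R(X, Y)V = 0 for all X, Y,
which makes every term of the trace Ric(Y, V) vanish. The argument is local:
`parallel_of_killing_gradient` gives ∇V = 0 for a metric on a vector space, and
`localCurvature_eq_zero_of_parallel` kills the curvature. What remains is to read the hypotheses in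
a chart. The Killing condition tests global fields only, so coordinate fields are first cut off by a
bump function; `killing_equation_gradInChart` then yields the coordinate Killing equation. -/

namespace KillingPotential

open ContinuousLinearMap
open scoped Topology

set_option maxSynthPendingDepth 3

/-! ### Parallel fields and curvature on a vector space. -/

section Local

variable {E : Type*} [NormedAddCommGroup E] [NormedSpace ℝ E]

/-- The Christoffel symbols `w ↦ Γ(v, w)` as a continuous linear map. -/
noncomputable def christoffelCLM (G : E → E →L[ℝ] E →L[ℝ] ℝ) (v y : E) : E →L[ℝ] E :=
  (G y).inverse ∘L ((1 / 2 : ℝ) • (fderiv ℝ G y v + (fderiv ℝ G y).flip v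
    - ((fderiv ℝ G y).flip v).flip))

theorem christoffelCLM_apply (G : E → E →L[ℝ] E →L[ℝ] ℝ) (v y w : E) :
    christoffelCLM G v y w = christoffel G y v w := by
  simp only [christoffelCLM, christoffel, coe_comp, Function.comp_apply]
  rfl

theorem isInvertible_of_pos [FiniteDimensional ℝ E] {B : E →L[ℝ] E →L[ℝ] ℝ}
    (hB : ∀ v, v ≠ 0 → 0 < B v v) : B.IsInvertible :=
  exists_equiv_of_pos B hB

theorem contDiffAt_inverse [CompleteSpace E] {G : E → E →L[ℝ] E →L[ℝ] ℝ} {y : E}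
    (hG : ContDiffAt ℝ ∞ G y) (hy : (G y).IsInvertible) :
    ContDiffAt ℝ ∞ (fun q ↦ (G q).inverse) y :=
  ContDiffAt.comp (g := ContinuousLinearMap.inverse) y hy.contDiffAt_map_inverse hG

theorem contDiffAt_christoffelCLM [CompleteSpace E] {G : E → E →L[ℝ] E →L[ℝ] ℝ} {y : E}
    (hG : ContDiffAt ℝ ∞ G y) (hy : (G y).IsInvertible) (v : E) :
    ContDiffAt ℝ ∞ (christoffelCLM G v) y := by
  have hD : ContDiffAt ℝ ∞ (fderiv ℝ G) y := hG.fderiv_right (by simp)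
  have h1 : ContDiffAt ℝ ∞ (fun q ↦ fderiv ℝ G q v) y := hD.clm_apply contDiffAt_const
  have h2 : ContDiffAt ℝ ∞ (fun q ↦ (fderiv ℝ G q).flip v) y :=
    ((flipₗᵢ ℝ E E (E →L[ℝ] ℝ)).contDiff.contDiffAt.comp y hD).clm_apply contDiffAt_const
  have h3 : ContDiffAt ℝ ∞ (fun q ↦ ((fderiv ℝ G q).flip v).flip) y :=
    (flipₗᵢ ℝ E E ℝ).contDiff.contDiffAt.comp y h2
  exact (contDiffAt_inverse hG hy).clm_comp (((h1.add h2).sub h3).const_smul _)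

theorem two_le_infty : minSmoothness ℝ 2 ≤ ∞ := by
  simpa using WithTop.coe_le_coe.2 (le_top : (2 : ℕ∞) ≤ ⊤)

/-- The curvature annihilates parallel vector fields. -/
theorem localCurvature_eq_zero_of_parallel [CompleteSpace E] {G : E → E →L[ℝ] E →L[ℝ] ℝ} {y : E}
    (hG : ContDiffAt ℝ ∞ G y) (hy : (G y).IsInvertible) {V : E → E} (hV : ContDiffAt ℝ ∞ V y)
    (hpar : ∀ᶠ q in 𝓝 y, ∀ a, fderiv ℝ V q a = - christoffel G q a (V q)) (X Y : E) :
    localCurvature G y X Y (V y) = 0 := by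
  have hVd : DifferentiableAt ℝ V y := hV.differentiableAt (by simp)
  have hDV : DifferentiableAt ℝ (fderiv ℝ V) y :=
    (hV.fderiv_right (m := ∞) (by simp)).differentiableAt (by simp)
  -- Differentiate ∂_a V = -Γ(a, V) along b. The product rule separates the derivative of Γ with V
  -- frozen at `y` from Γ(a, ∂_b V) = -Γ(a, Γ(b, V)).
  have key : ∀ a b : E, fderiv ℝ (fun q ↦ christoffel G q a (V y)) y b
      = christoffel G y a (christoffel G y b (V y)) - fderiv ℝ (fderiv ℝ V) y b a := by
    intro a b
    have hC : DifferentiableAt ℝ (christoffelCLM G a) y :=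
      (contDiffAt_christoffelCLM hG hy a).differentiableAt (by simp)
    have e1 : fderiv ℝ (fun q ↦ christoffel G q a (V y)) y b
        = fderiv ℝ (christoffelCLM G a) y b (V y) := by
      simp_rw [← christoffelCLM_apply]
      rw [fderiv_clm_apply hC (differentiableAt_const _)]
      simp
    have e2 : fderiv ℝ (fun q ↦ christoffelCLM G a q (V q)) y b
        = fderiv ℝ (christoffelCLM G a) y b (V y) + christoffelCLM G a y (fderiv ℝ V y b) := by
      rw [fderiv_clm_apply hC hVd]
      simp [add_comm]
    have e3 : (fun q ↦ christoffelCLM G a q (V q)) =ᶠ[𝓝 y] fun q ↦ - fderiv ℝ V q a := by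
      filter_upwards [hpar] with q hq
      rw [hq a, christoffelCLM_apply, neg_neg]
    have e4 : fderiv ℝ (fun q ↦ - fderiv ℝ V q a) y b = - fderiv ℝ (fderiv ℝ V) y b a := by
      rw [fderiv_fun_neg, fderiv_clm_apply hDV (differentiableAt_const _)]
      simp
    rw [e3.fderiv_eq, e4, hpar.self_of_nhds b, map_neg, christoffelCLM_apply] at e2
    rw [e1, sub_eq_add_neg, e2]
    abel
  have hsymm : fderiv ℝ (fderiv ℝ V) y X Y = fderiv ℝ (fderiv ℝ V) y Y X :=
    (hV.isSymmSndFDerivAt two_le_infty).eq X Y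
  -- The ΓΓ terms cancel in pairs, and the second derivatives of V by symmetry.
  rw [localCurvature, key, key, hsymm]
  abel

/-- The Ricci curvature annihilates parallel vector fields. -/
theorem localRicci_eq_zero_of_parallel [FiniteDimensional ℝ E] {G : E → E →L[ℝ] E →L[ℝ] ℝ} {y : E}
    (hG : ContDiffAt ℝ ∞ G y) (hy : (G y).IsInvertible) {V : E → E} (hV : ContDiffAt ℝ ∞ V y)
    (hpar : ∀ᶠ q in 𝓝 y, ∀ a, fderiv ℝ V q a = - christoffel G q a (V q)) (Y : E) :
    localRicci G y Y (V y) = 0 := by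
  have : CompleteSpace E := FiniteDimensional.complete ℝ E
  refine Finset.sum_eq_zero fun i _ ↦ ?_
  rw [localCurvature_eq_zero_of_parallel hG hy hV hpar, map_zero]

/-- If the gradient `V` of a function `w` is a Killing field, then it is parallel. -/
theorem parallel_of_killing_gradient {G : E → E →L[ℝ] E →L[ℝ] ℝ} {y : E}
    (hG : ContDiffAt ℝ ∞ G y) (hy : (G y).IsInvertible) (hs : ∀ᶠ q in 𝓝 y, ∀ a b, G q a b = G q b a)
    {V : E → E} (hV : ContDiffAt ℝ ∞ V y) {w : E → ℝ} (hw : ContDiffAt ℝ ∞ w y)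
    (hgrad : ∀ᶠ q in 𝓝 y, G q (V q) = fderiv ℝ w q)
    (hkill : ∀ a b, fderiv ℝ (fun q ↦ G q a b) y (V y) + G y (fderiv ℝ V y a) b
      + G y a (fderiv ℝ V y b) = 0) (a : E) :
    fderiv ℝ V y a = - christoffel G y a (V y) := by
  have hGd : DifferentiableAt ℝ G y := hG.differentiableAt (by simp)
  have hVd : DifferentiableAt ℝ V y := hV.differentiableAt (by simp)
  have hDG : ∀ a b c, fderiv ℝ (fun q ↦ G q a b) y c = fderiv ℝ G y c a b := by
    intro a b c
    have h1 : DifferentiableAt ℝ (fun q ↦ G q a) y := hGd.clm_apply (differentiableAt_const _)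
    rw [fderiv_clm_apply h1 (differentiableAt_const _),
      fderiv_clm_apply hGd (differentiableAt_const _)]
    simp
  have hDs : ∀ a b c, fderiv ℝ G y c a b = fderiv ℝ G y c b a := by
    intro a b c
    rw [← hDG, ← hDG]
    have h : (fun q ↦ G q a b) =ᶠ[𝓝 y] fun q ↦ G q b a := hs.mono fun q hq ↦ hq a b
    rw [h.fderiv_eq]
  -- The derivative of G(V) = dw.
  have hH : ∀ a b, G y (fderiv ℝ V y a) b + fderiv ℝ G y a (V y) b
      = fderiv ℝ (fderiv ℝ w) y a b := by
    intro a b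
    rw [← Filter.EventuallyEq.fderiv_eq hgrad, fderiv_clm_apply hGd hVd]
    simp
  have hsymm : ∀ a b, fderiv ℝ (fderiv ℝ w) y a b = fderiv ℝ (fderiv ℝ w) y b a := fun a b ↦
    (hw.isSymmSndFDerivAt two_le_infty).eq a b
  have key : G y (fderiv ℝ V y a) = - christoffelFirst G y a (V y) := by
    ext b
    rw [neg_apply, christoffelFirst_apply]
    have h1 := hkill a b
    rw [hDG, hs.self_of_nhds a] at h1
    have h2 := hH a b
    have h3 := hH b a
    have h4 := hsymm a b
    have h5 := hDs a (V y) b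
    -- `h2 - h3` with `h4` gives the skew part of G(DV a, b), and `h1` the symmetric part; half
    -- their sum is the Christoffel formula.
    linarith
  rw [christoffel, ← neg_eq_iff_eq_neg.2 key]
  obtain ⟨e, he⟩ := hy
  simp [← he]

end Local

/-! ### Transfer between the manifold and its charts. -/

section Manifold

variable {E : Type*} [NormedAddCommGroup E] [NormedSpace ℝ E]
  {M : Type*} [TopologicalSpace M] [ChartedSpace E M] [IsManifold 𝓘(ℝ, E) ∞ M]
  (g : ContMDiffRiemannianMetric 𝓘(ℝ, E) ∞ E (fun x : M ↦ TangentSpace 𝓘(ℝ, E) x))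

/-- The field with constant coordinates `a` in the preferred chart around `p`. -/
noncomputable def coordField (p : M) (a : E) (q : M) : TangentSpace 𝓘(ℝ, E) q :=
  mpullback 𝓘(ℝ, E) 𝓘(ℝ, E) (extChartAt 𝓘(ℝ, E) p) (fun _ ↦ a) q

theorem isManifold_one : IsManifold 𝓘(ℝ, E) 1 M :=
  IsManifold.of_le (n := ∞) (by simp)

theorem mfderiv_extChartAt_symm_comp {p : M} {y : E} (hy : y ∈ (extChartAt 𝓘(ℝ, E) p).target) :
    (mfderiv 𝓘(ℝ, E) 𝓘(ℝ, E) (extChartAt 𝓘(ℝ, E) p).symm y) ∘L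
      (mfderiv 𝓘(ℝ, E) 𝓘(ℝ, E) (extChartAt 𝓘(ℝ, E) p) ((extChartAt 𝓘(ℝ, E) p).symm y)) =
      ContinuousLinearMap.id _ _ := by
  have : IsManifold 𝓘(ℝ, E) 1 M := isManifold_one
  simpa using mfderivWithin_extChartAt_symm_comp_mfderiv_extChartAt (I := 𝓘(ℝ, E)) hy

theorem mfderiv_extChartAt_comp_symm {p : M} {y : E} (hy : y ∈ (extChartAt 𝓘(ℝ, E) p).target) :
    (mfderiv 𝓘(ℝ, E) 𝓘(ℝ, E) (extChartAt 𝓘(ℝ, E) p) ((extChartAt 𝓘(ℝ, E) p).symm y)) ∘L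
      (mfderiv 𝓘(ℝ, E) 𝓘(ℝ, E) (extChartAt 𝓘(ℝ, E) p).symm y) =
      ContinuousLinearMap.id _ _ := by
  have : IsManifold 𝓘(ℝ, E) 1 M := isManifold_one
  simpa using mfderiv_extChartAt_comp_mfderivWithin_extChartAt_symm (I := 𝓘(ℝ, E)) hy

/-- The derivative of the inverse of the preferred chart around `p`, as a map of the model space. -/
noncomputable def symmDeriv (p : M) (y : E) : E →L[ℝ] E :=
  mfderiv 𝓘(ℝ, E) 𝓘(ℝ, E) (extChartAt 𝓘(ℝ, E) p).symm y

/-- The metric at `q`, as a bilinear form on the model space. -/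
noncomputable def modelInner (q : M) : E →L[ℝ] E →L[ℝ] ℝ := g.inner q

theorem isInvertible_symmDeriv {p : M} {y : E}
    (hy : y ∈ (extChartAt 𝓘(ℝ, E) p).target) : (symmDeriv p y).IsInvertible :=
  IsInvertible.of_inverse (mfderiv_extChartAt_symm_comp hy) (mfderiv_extChartAt_comp_symm hy)

theorem inverse_symmDeriv_apply {p : M} {y : E} (hy : y ∈ (extChartAt 𝓘(ℝ, E) p).target) (a : E) :
    (symmDeriv p y).inverse (symmDeriv p y a) = a := by
  obtain ⟨e, he⟩ := isInvertible_symmDeriv hy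
  simp [← he]

/-- Pulling back applies the inverse of the chart's derivative, which is the derivative of the
inverse chart. -/
theorem coordField_symm {p : M} {y : E} (hy : y ∈ (extChartAt 𝓘(ℝ, E) p).target) (a : E) :
    coordField p a ((extChartAt 𝓘(ℝ, E) p).symm y) = symmDeriv p y a :=
  DFunLike.congr_fun
    (inverse_eq (mfderiv_extChartAt_comp_symm hy) (mfderiv_extChartAt_symm_comp hy)) a

theorem contMDiffOn_coordField [CompleteSpace E] (p : M) (a : E) :
    ContMDiffOn 𝓘(ℝ, E) 𝓘(ℝ, E).tangent ∞
      (fun q ↦ (⟨q, coordField p a q⟩ : TangentBundle 𝓘(ℝ, E) M)) (chartAt E p).source := by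
  have : IsManifold 𝓘(ℝ, E) 1 M := isManifold_one
  intro q hq
  refine ContMDiffAt.contMDiffWithinAt (ContMDiffAt.mpullback_vectorField_preimage (n := ∞)
    (contMDiffAt_vectorSpace_iff_contDiffAt.2 contDiffAt_const) (contMDiffAt_extChartAt' hq)
    (isInvertible_mfderiv_extChartAt (by simpa using hq)) (by simp))

theorem contMDiffAt_extChartAt_symm' {p : M} {y : E} (hy : y ∈ (extChartAt 𝓘(ℝ, E) p).target) :
    ContMDiffAt 𝓘(ℝ, E) 𝓘(ℝ, E) ∞ (extChartAt 𝓘(ℝ, E) p).symm y :=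
  (contMDiffOn_extChartAt_symm p).contMDiffAt ((isOpen_extChartAt_target p).mem_nhds hy)

theorem metricInChart_apply (p : M) (y a b : E) :
    metricInChart g p y a b = modelInner g ((extChartAt 𝓘(ℝ, E) p).symm y)
      (symmDeriv p y a) (symmDeriv p y b) := rfl

theorem contMDiffAt_inner {Y Z : ∀ p : M, TangentSpace 𝓘(ℝ, E) p} {q : M}
    (hY : ContMDiffAt 𝓘(ℝ, E) 𝓘(ℝ, E).tangent ∞
      (fun q ↦ (⟨q, Y q⟩ : TangentBundle 𝓘(ℝ, E) M)) q)
    (hZ : ContMDiffAt 𝓘(ℝ, E) 𝓘(ℝ, E).tangent ∞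
      (fun q ↦ (⟨q, Z q⟩ : TangentBundle 𝓘(ℝ, E) M)) q) :
    ContMDiffAt 𝓘(ℝ, E) 𝓘(ℝ, ℝ) ∞ (fun q ↦ g.inner q (Y q) (Z q)) q := by
  -- View the function as a section of the trivial line bundle, so that smooth bundle maps can be
  -- applied to sections.
  have : ContMDiffAt 𝓘(ℝ, E) (𝓘(ℝ, E).prod 𝓘(ℝ, ℝ)) ∞
      (fun q ↦ TotalSpace.mk' ℝ (E := Bundle.Trivial M ℝ) q (g.inner q (Y q) (Z q))) q := by
    apply ContMDiffAt.clm_bundle_apply₂ (F₁ := E) (F₂ := E)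
    · exact g.contMDiff.contMDiffAt
    · exact hY
    · exact hZ
  simp only [contMDiffAt_totalSpace] at this
  exact this.2

/-- In finite dimension smoothness can be tested on fixed vectors `a`, `b`, where the coefficient is
the inner product of two coordinate fields. -/
theorem contDiffAt_metricInChart [FiniteDimensional ℝ E] {p : M} {y : E}
    (hy : y ∈ (extChartAt 𝓘(ℝ, E) p).target) : ContDiffAt ℝ ∞ (metricInChart g p) y := by
  have : CompleteSpace E := FiniteDimensional.complete ℝ E
  have hT := isOpen_extChartAt_target (I := 𝓘(ℝ, E)) p
  refine ContDiffOn.contDiffAt (s := (extChartAt 𝓘(ℝ, E) p).target) ?_ (hT.mem_nhds hy)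
  refine contDiffOn_clm_apply.2 fun a ↦ contDiffOn_clm_apply.2 fun b ↦ fun z hz ↦
    ContDiffAt.contDiffWithinAt ?_
  have hz' : (extChartAt 𝓘(ℝ, E) p).symm z ∈ (chartAt E p).source := by
    simpa using (extChartAt 𝓘(ℝ, E) p).map_target hz
  have hc := fun a : E ↦ (contMDiffOn_coordField p a).contMDiffAt
    ((chartAt E p).open_source.mem_nhds hz')
  have h := ((contMDiffAt_inner g (hc a) (hc b)).comp z
    (contMDiffAt_extChartAt_symm' hz)).contDiffAt
  refine h.congr_of_eventuallyEq ?_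
  filter_upwards [hT.mem_nhds hz] with x hx
  rw [metricInChart_apply, ← coordField_symm hx, ← coordField_symm hx]
  rfl

theorem metricInChart_pos {p : M} {y : E} (hy : y ∈ (extChartAt 𝓘(ℝ, E) p).target) (v : E)
    (hv : v ≠ 0) : 0 < metricInChart g p y v v := by
  refine g.pos _ _ fun h ↦ hv ?_
  have h' : symmDeriv p y v = 0 := h
  rw [← inverse_symmDeriv_apply hy v, h', map_zero]

theorem modelInner_symm (q : M) (a b : E) : modelInner g q a b = modelInner g q b a :=
  g.symm q a b

theorem metricInChart_symm (p : M) (y a b : E) :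
    metricInChart g p y a b = metricInChart g p y b a := by
  rw [metricInChart_apply, metricInChart_apply, modelInner_symm]

/-- The gradient of `u` in the preferred chart around `p`. -/
noncomputable def gradInChart (u : M → ℝ) (p : M) (y : E) : E :=
  (metricInChart g p y).inverse (fderiv ℝ (u ∘ (extChartAt 𝓘(ℝ, E) p).symm) y)

variable {g} {u : M → ℝ}

theorem contDiffAt_comp_extChartAt_symm (hu : ContMDiff 𝓘(ℝ, E) 𝓘(ℝ, ℝ) ∞ u) {p : M} {y : E}
    (hy : y ∈ (extChartAt 𝓘(ℝ, E) p).target) :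
    ContDiffAt ℝ ∞ (u ∘ (extChartAt 𝓘(ℝ, E) p).symm) y :=
  (hu.contMDiffAt.comp y (contMDiffAt_extChartAt_symm' hy)).contDiffAt

theorem fderiv_comp_extChartAt_symm {p : M} {y : E} {h : M → ℝ}
    (hy : y ∈ (extChartAt 𝓘(ℝ, E) p).target)
    (hh : MDifferentiableAt 𝓘(ℝ, E) 𝓘(ℝ, ℝ) h ((extChartAt 𝓘(ℝ, E) p).symm y)) (b : E) :
    fderiv ℝ (h ∘ (extChartAt 𝓘(ℝ, E) p).symm) y b
      = mvfderiv 𝓘(ℝ, E) h ((extChartAt 𝓘(ℝ, E) p).symm y)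
        (symmDeriv p y b) := by
  have h1 := mvfderiv_comp_apply y hh
    ((contMDiffAt_extChartAt_symm' hy).mdifferentiableAt (by simp)) b
  have h2 : mfderiv 𝓘(ℝ, E) 𝓘(ℝ, ℝ) (h ∘ (extChartAt 𝓘(ℝ, E) p).symm) y
    = fderiv ℝ (h ∘ (extChartAt 𝓘(ℝ, E) p).symm) y := mfderiv_eq_fderiv
  exact (DFunLike.congr_fun h2 b).symm.trans h1

theorem mlieBracket_eq_lieBracket_model (V W : E → E) (y : E) :
    mlieBracket 𝓘(ℝ, E) V W y = lieBracket ℝ V W y := by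
  have h := congrFun (mlieBracketWithin_eq_lieBracketWithin (𝕜 := ℝ) (V := V) (W := W)
    (s := Set.univ)) y
  rw [lieBracketWithin_univ] at h
  exact h

theorem lieDerivMetric_eq (X Y Z : ∀ p : M, TangentSpace 𝓘(ℝ, E) p) (q : M) :
    lieDerivMetric g X Y Z q = mvfderiv 𝓘(ℝ, E) (fun q ↦ g.inner q (Y q) (Z q)) q (X q)
      - modelInner g q (mlieBracket 𝓘(ℝ, E) X Y q) (Z q)
      - modelInner g q (Y q) (mlieBracket 𝓘(ℝ, E) X Z q) := rfl

variable [FiniteDimensional ℝ E]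

theorem metricInChart_gradInChart {p : M} {y : E} (hy : y ∈ (extChartAt 𝓘(ℝ, E) p).target) :
    metricInChart g p y (gradInChart g u p y)
      = fderiv ℝ (u ∘ (extChartAt 𝓘(ℝ, E) p).symm) y := by
  obtain ⟨e, he⟩ := isInvertible_of_pos (metricInChart_pos g hy)
  simp [gradInChart, ← he]

theorem contDiffAt_gradInChart (hu : ContMDiff 𝓘(ℝ, E) 𝓘(ℝ, ℝ) ∞ u) {p : M} {y : E}
    (hy : y ∈ (extChartAt 𝓘(ℝ, E) p).target) : ContDiffAt ℝ ∞ (gradInChart g u p) y := by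
  have : CompleteSpace E := FiniteDimensional.complete ℝ E
  exact (contDiffAt_inverse (contDiffAt_metricInChart g hy)
    (isInvertible_of_pos (metricInChart_pos g hy))).clm_apply
    ((contDiffAt_comp_extChartAt_symm hu hy).fderiv_right (by simp))

/-- Both sides pair with every vector to give du, and the metric is nondegenerate. -/
theorem symmDeriv_gradInChart (hu : ContMDiff 𝓘(ℝ, E) 𝓘(ℝ, ℝ) ∞ u) {p : M} {y : E}
    (hy : y ∈ (extChartAt 𝓘(ℝ, E) p).target) :
    symmDeriv p y (gradInChart g u p y) = grad g u ((extChartAt 𝓘(ℝ, E) p).symm y) := by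
  set q := (extChartAt 𝓘(ℝ, E) p).symm y with hq
  have h1 : modelInner g q (symmDeriv p y (gradInChart g u p y)) = modelInner g q (grad g u q) := by
    ext c
    obtain ⟨b, rfl⟩ : ∃ b, symmDeriv p y b = c := by
      obtain ⟨e, he⟩ := isInvertible_symmDeriv hy
      exact ⟨e.symm c, by simp [← he]⟩
    rw [← metricInChart_apply, metricInChart_gradInChart hy,
      fderiv_comp_extChartAt_symm hy (hu.mdifferentiableAt (by simp))]
    exact (inner_grad g u q _).symm
  obtain ⟨e, he⟩ := isInvertible_of_pos (B := modelInner g q) (g.pos q)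
  rw [← he] at h1
  exact e.injective h1

theorem mpullback_grad (hu : ContMDiff 𝓘(ℝ, E) 𝓘(ℝ, ℝ) ∞ u) {p : M} {y : E}
    (hy : y ∈ (extChartAt 𝓘(ℝ, E) p).target) :
    mpullback 𝓘(ℝ, E) 𝓘(ℝ, E) (extChartAt 𝓘(ℝ, E) p).symm (grad g u) y
      = gradInChart g u p y :=
  (congrArg (symmDeriv p y).inverse (symmDeriv_gradInChart hu hy)).symm.trans
    (inverse_symmDeriv_apply hy _)

/-- Near `p`, every field with constant coordinates in the chart agrees with a global smooth vector
field. -/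
theorem exists_smooth_extension_coordField [T2Space M] (p : M) :
    ∃ Y : E → ∀ q : M, TangentSpace 𝓘(ℝ, E) q, (∀ a, IsSmoothVectorField (Y a)) ∧
      ∀ᶠ q in 𝓝 p, ∀ a, Y a q = coordField p a q := by
  have : CompleteSpace E := FiniteDimensional.complete ℝ E
  obtain ⟨ρ⟩ : Nonempty (SmoothBumpFunction 𝓘(ℝ, E) p) := inferInstance
  -- The bump does not depend on `a`, so one neighbourhood serves all `a`.
  refine ⟨fun a ↦ (ρ : M → ℝ) • coordField p a, fun a ↦ ?_, ?_⟩
  · exact ContMDiffOn.smul_section_of_tsupport ρ.contMDiff.contMDiffOn (chartAt E p).open_source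
      ρ.tsupport_subset_chartAt_source (contMDiffOn_coordField p a)
  · filter_upwards [ρ.eventuallyEq_one] with q hq a
    simp [hq]

/-- Brackets commute with pullback by the inverse chart, where `Y` becomes the constant `a` and [V,
a] = -DV(a). -/
theorem mlieBracket_grad_coordField (hu : IsKillingPotential g u) {p : M} {y : E}
    (hy : y ∈ (extChartAt 𝓘(ℝ, E) p).target) (a : E) {Y : ∀ q : M, TangentSpace 𝓘(ℝ, E) q}
    (hY : IsSmoothVectorField Y)
    (hYa : ∀ᶠ x in 𝓝 y, Y ((extChartAt 𝓘(ℝ, E) p).symm x)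
      = coordField p a ((extChartAt 𝓘(ℝ, E) p).symm x)) :
    mlieBracket 𝓘(ℝ, E) (grad g u) Y ((extChartAt 𝓘(ℝ, E) p).symm y)
      = symmDeriv p y (- fderiv ℝ (gradInChart g u p) y a) := by
  have : CompleteSpace E := FiniteDimensional.complete ℝ E
  have : IsManifold 𝓘(ℝ, E) (minSmoothness ℝ 3) M := IsManifold.of_le (n := ∞) (by
    simpa using WithTop.coe_le_coe.2 (le_top : (3 : ℕ∞) ≤ ⊤))
  have hT := isOpen_extChartAt_target (I := 𝓘(ℝ, E)) p
  have h := mpullback_mlieBracket (hu.killing.smooth.mdifferentiableAt (by simp))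
    (hY.mdifferentiableAt (by simp)) (contMDiffAt_extChartAt_symm' hy) two_le_infty
  have h1 : mpullback 𝓘(ℝ, E) 𝓘(ℝ, E) (extChartAt 𝓘(ℝ, E) p).symm (grad g u)
      =ᶠ[𝓝 y] gradInChart g u p := by
    filter_upwards [hT.mem_nhds hy] with x hx using mpullback_grad hu.smooth hx
  have h2 : mpullback 𝓘(ℝ, E) 𝓘(ℝ, E) (extChartAt 𝓘(ℝ, E) p).symm Y =ᶠ[𝓝 y] fun _ ↦ a := by
    filter_upwards [hT.mem_nhds hy, hYa] with x hx hxa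
    exact (congrArg (symmDeriv p x).inverse (hxa.trans (coordField_symm hx a))).trans
      (inverse_symmDeriv_apply hx a)
  rw [h1.mlieBracket_vectorField_eq h2] at h
  have h3 : lieBracket ℝ (gradInChart g u p) (fun _ ↦ a) y
      = - fderiv ℝ (gradInChart g u p) y a := by
    simp [lieBracket]
  rw [← h3, ← mlieBracket_eq_lieBracket_model]
  obtain ⟨e, he⟩ := isInvertible_symmDeriv hy
  have h4 : (symmDeriv p y).inverse
      (mlieBracket 𝓘(ℝ, E) (grad g u) Y ((extChartAt 𝓘(ℝ, E) p).symm y))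
      = mlieBracket 𝓘(ℝ, E) (gradInChart g u p) (fun _ ↦ a) y := h
  rw [← h4, ← he, inverse_equiv]
  exact (e.apply_symm_apply _).symm

/-- The Killing equation in the preferred chart. -/
theorem killing_equation_gradInChart [T2Space M] (hu : IsKillingPotential g u) (p : M) :
    ∀ᶠ y in 𝓝 (extChartAt 𝓘(ℝ, E) p p), ∀ a b,
      fderiv ℝ (fun q ↦ metricInChart g p q a b) y (gradInChart g u p y)
        + metricInChart g p y (fderiv ℝ (gradInChart g u p) y a) b
        + metricInChart g p y a (fderiv ℝ (gradInChart g u p) y b) = 0 := by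
  obtain ⟨Y, hYs, hY⟩ := exists_smooth_extension_coordField (E := E) p
  have hT := isOpen_extChartAt_target (I := 𝓘(ℝ, E)) p
  have hc := continuousAt_extChartAt_symm (I := 𝓘(ℝ, E)) p
  have hY' := hc.eventually (by simpa using hY)
  -- Brackets and derivatives at `y` need agreement near `y`, not only at `y`; hence
  -- `eventually_nhds`.
  filter_upwards [hT.mem_nhds (mem_extChartAt_target p), hY'.eventually_nhds] with y hy hYy a b
  have hk := hu.killing.lieDeriv_eq_zero (Y a) (Y b) (hYs a) (hYs b)
    ((extChartAt 𝓘(ℝ, E) p).symm y)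
  rw [lieDerivMetric_eq, mlieBracket_grad_coordField hu hy a (hYs a) (hYy.mono fun x hx ↦ hx a),
    mlieBracket_grad_coordField hu hy b (hYs b) (hYy.mono fun x hx ↦ hx b),
    ← symmDeriv_gradInChart hu.smooth hy, ← fderiv_comp_extChartAt_symm hy
      ((contMDiffAt_inner g (hYs a).contMDiffAt (hYs b).contMDiffAt).mdifferentiableAt (by simp)),
    hYy.self_of_nhds a, hYy.self_of_nhds b, coordField_symm hy, coordField_symm hy,
    ← metricInChart_apply, ← metricInChart_apply] at hk
  have he : (fun q ↦ g.inner q (Y a q) (Y b q)) ∘ (extChartAt 𝓘(ℝ, E) p).symm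
      =ᶠ[𝓝 y] fun q ↦ metricInChart g p q a b := by
    filter_upwards [hYy, hT.mem_nhds hy] with x hx hxT
    rw [metricInChart_apply, ← coordField_symm hxT, ← coordField_symm hxT, ← hx, ← hx]
    rfl
  rw [he.fderiv_eq, map_neg, map_neg, neg_apply] at hk
  linarith

/-- A gradient Killing field is parallel. -/
theorem parallel_gradInChart [T2Space M] (hu : IsKillingPotential g u) (p : M) :
    ∀ᶠ y in 𝓝 (extChartAt 𝓘(ℝ, E) p p), ∀ a, fderiv ℝ (gradInChart g u p) y a
      = - christoffel (metricInChart g p) y a (gradInChart g u p y) := by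
  have hT := isOpen_extChartAt_target (I := 𝓘(ℝ, E)) p
  filter_upwards [hT.mem_nhds (mem_extChartAt_target p), killing_equation_gradInChart hu p]
    with y hy hk a
  refine parallel_of_killing_gradient (contDiffAt_metricInChart g hy)
    (isInvertible_of_pos (metricInChart_pos g hy))
    (Filter.Eventually.of_forall fun q ↦ metricInChart_symm g p q)
    (contDiffAt_gradInChart hu.smooth hy) (contDiffAt_comp_extChartAt_symm hu.smooth hy) ?_ hk a
  filter_upwards [hT.mem_nhds hy] with q hq using metricInChart_gradInChart hq

/-- The gradient of a Killing potential annihilates the Ricci tensor. -/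
theorem ricci_grad_eq_zero [T2Space M] (hu : IsKillingPotential g u) (p : M)
    (v : TangentSpace 𝓘(ℝ, E) p) : ricci g p v (grad g u p) = 0 := by
  have : CompleteSpace E := FiniteDimensional.complete ℝ E
  have hy := mem_extChartAt_target (I := 𝓘(ℝ, E)) p
  have hgrad : mfderiv 𝓘(ℝ, E) 𝓘(ℝ, E) (extChartAt 𝓘(ℝ, E) p) p (grad g u p)
      = gradInChart g u p (extChartAt 𝓘(ℝ, E) p p) := by
    have h1 := symmDeriv_gradInChart (g := g) hu.smooth hy
    have h2 := DFunLike.congr_fun (mfderiv_extChartAt_comp_symm hy)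
      (gradInChart g u p (extChartAt 𝓘(ℝ, E) p p))
    have h3 : mfderiv 𝓘(ℝ, E) 𝓘(ℝ, E) (extChartAt 𝓘(ℝ, E) p)
        ((extChartAt 𝓘(ℝ, E) p).symm (extChartAt 𝓘(ℝ, E) p p))
        (grad g u ((extChartAt 𝓘(ℝ, E) p).symm (extChartAt 𝓘(ℝ, E) p p)))
        = gradInChart g u p (extChartAt 𝓘(ℝ, E) p p) := by
      rw [← h1]
      exact h2
    -- The base point φ⁻¹(φ p) equals `p` only propositionally, so it is rewritten at the end.
    rwa [extChartAt_to_inv] at h3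
  rw [ricci, hgrad]
  exact localRicci_eq_zero_of_parallel (contDiffAt_metricInChart g hy)
    (isInvertible_of_pos (metricInChart_pos g hy)) (contDiffAt_gradInChart hu.smooth hy)
    (parallel_gradInChart hu p) _

end Manifold

end KillingPotential

theorem corollary3p3
    {E : Type*} [NormedAddCommGroup E] [NormedSpace ℝ E] [FiniteDimensional ℝ E]
    {M : Type*} [TopologicalSpace M] [T2Space M] [ChartedSpace E M] [IsManifold 𝓘(ℝ, E) ∞ M]
    (g : ContMDiffRiemannianMetric 𝓘(ℝ, E) ∞ E (fun x : M ↦ TangentSpace 𝓘(ℝ, E) x))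
    (hg : KillingPotential.IsGeodesicallyComplete g)
    (u : M → ℝ) (hu : KillingPotential.IsKillingPotential g u) (p : M) :
    KillingPotential.ricci g p (KillingPotential.grad g u p) (KillingPotential.grad g u p) = 0 := by
  exact KillingPotential.ricci_grad_eq_zero hu p _
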